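/- Let $d>1$ be an integer and $\Omega=[0,1]^d$; all functions are complex-valued and identified when they agree almost everywhere. **Spaces on $\mathbb R^d$.** For $1<p<\infty$ and $m\in\mathbb N=\{1,2,\dots\}$ let $S^m_pW(\mathbb R^d)$ be the set of all $f\in L_p(\mathbb R^d)$ whose distributional derivatives $D^\alpha f$ belong to $L_p(\mathbb R^d)$ for all $\alpha\in\mathbb N_0^d$ with $|\alpha|_\infty=\max_j\alpha_j\le m$, with the norm $\|f|S^m_pW(\mathbb R^d)\|=\sum_{|\alpha|_\infty\le m}\|D^\alpha f|L_p(\mathbb R^d)\|$. For $1\le p\le\infty$ and $r>0$ let $m\in\mathbb N$ be such that $m-1\le r<m$, and let $S^r_{p,p}B(\mathbb R^d)$ be the set of all $f\in L_p(\mathbb R^d)$ for which $$\|f|S^r_{p,p}B(\mathbb R^d)\|=\sum_{e\subset\{1,\dots,d\}}\Big(\sum_{k\in\mathbb N_0^d,\ k_i=0\text{ for }i\notin e}2^{r|k|_1p}\,\omega^e_m(f,2^{-k})_p^p\Big)^{1/p}$$ is finite (with the supremum over $k$ in place of the inner sum if $p=\infty$). Here $|k|_1=k_1+\dots+k_d$,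 $2^{-k}=(2^{-k_1},\dots,2^{-k_d})$, $$\omega^e_m(f,t)_p=\sup_{|h_i|<t_i,\ i\in e}\Big\|\prod_{i\in e}\Delta^m_{h_i,i}f\,\Big|\,L_p(\mathbb R^d)\Big\|,$$ and $\Delta^m_{\eta,i}f(x)=\sum_{\ell=0}^m(-1)^{m-\ell}\binom m\ell f(x+\ell\eta\,\mathbf e_i)$ is the $m$-th difference in direction $i$ ($\mathbf e_i$ the $i$-th unit vector; the empty product is the identity). **Spaces on $\Omega$.** For $X(\mathbb R^d)$ one of these spaces, $X(\Omega)$ is the set of all restrictions $g|_\Omega$, $g\in X(\mathbb R^d)$, with the norm $\|f|X(\Omega)\|=\inf\{\|g|X(\mathbb R^d)\|:\ g\in X(\mathbb R^d),\ g|_\Omega=f\}$. **Theorem.** (i) Let $1<p<\infty$ and $m\in\mathbb N$. There exists no constant $C>0$ such that $$\|f\cdot g|S^m_pW(\Omega)\|\le C\big(\|f|S^m_pW(\Omega)\|\cdot\|g|L_\infty(\Omega)\|+\|f|L_\infty(\Omega)\|\cdot\|g|S^m_pW(\Omega)\|\big)$$ holds for all $f,g\in S^m_pW(\Omega)$. (ii)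 Let $1\le p\le\infty$ and $r>0$. There exists no constant $C>0$ such that $$\|f\cdot g|S^r_{p,p}B(\Omega)\|\le C\big(\|f|S^r_{p,p}B(\Omega)\|\cdot\|g|L_\infty(\Omega)\|+\|f|L_\infty(\Omega)\|\cdot\|g|S^r_{p,p}B(\Omega)\|\big)$$ holds for all $f,g\in S^r_{p,p}B(\Omega)\cap L_\infty(\Omega)$ with $f\cdot g\in S^r_{p,p}B(\Omega)$. -/

import Mathlib

open MeasureTheory
open scoped ENNReal NNReal ContDiff

namespace DominatingMixed

/-- Composition of one operator `T i` per coordinate `i`, namely `T 0 ∘ T 1 ∘ ⋯ ∘ T (d - 1)`.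
It is used only for operators that commute on the functions in question. -/
def coordComp {d : ℕ} {F : Type*} (T : Fin d → F → F) (f : F) : F :=
  (List.finRange d).foldr T f

section Sobolev

/-- The classical partial derivative in direction `i`. -/
noncomputable def partialDeriv {d : ℕ} (i : Fin d) (φ : (Fin d → ℝ) → ℝ) : (Fin d → ℝ) → ℝ :=
  fun x => fderiv ℝ φ x (Pi.single i 1)

/-- The classical derivative `D^α φ`, for a multi-index `α`. -/
noncomputable def multiDeriv {d : ℕ} (α : Fin d → ℕ) (φ : (Fin d → ℝ) → ℝ) :
    (Fin d → ℝ) → ℝ :=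
  coordComp (fun i => (partialDeriv i)^[α i]) φ

/-- The distribution `D^α f` is given by the locally integrable function `v`. -/
structure HasWeakDeriv {d : ℕ} (α : Fin d → ℕ) (f v : (Fin d → ℝ) → ℂ) : Prop where
  locInt : LocallyIntegrable f volume
  locInt_deriv : LocallyIntegrable v volume
  integral_eq : ∀ φ : (Fin d → ℝ) → ℝ, ContDiff ℝ ∞ φ → HasCompactSupport φ →
    ∫ x, multiDeriv α φ x • f x = (-1 : ℝ) ^ (∑ i, α i) • ∫ x, φ x • v x

/-- `‖D^α f | L_p(ℝ^d)‖`; it is `∞` if `D^α f` is not a locally integrable function.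
Weak derivatives are unique up to null sets, so all `v` that enter the infimum contribute the
same number. -/
noncomputable def weakDerivNorm {d : ℕ} (α : Fin d → ℕ) (p : ℝ≥0∞) (f : (Fin d → ℝ) → ℂ) :
    ℝ≥0∞ :=
  ⨅ (v : (Fin d → ℝ) → ℂ) (_ : HasWeakDeriv α f v), eLpNorm v p volume

/-- Membership in the Sobolev space of dominating mixed smoothness `S^m_p W(ℝ^d)`. -/
def MemSobolevMix {d : ℕ} (m : ℕ) (p : ℝ≥0∞) (f : (Fin d → ℝ) → ℂ) : Prop :=
  MemLp f p volume ∧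
    ∀ α : Fin d → ℕ, (∀ j, α j ≤ m) → ∃ v, HasWeakDeriv α f v ∧ MemLp v p volume

/-- The norm of `S^m_p W(ℝ^d)`: the sum of `‖D^α f | L_p‖` over all `α ∈ {0, …, m}^d`. -/
noncomputable def sobolevMixNorm {d : ℕ} (m : ℕ) (p : ℝ≥0∞) (f : (Fin d → ℝ) → ℂ) : ℝ≥0∞ :=
  ∑ α ∈ Fintype.piFinset (fun _ : Fin d => Finset.range (m + 1)), weakDerivNorm α p f

end Sobolev

section Besov

/-- The `m`-th order difference `Δ_{h,j}^m f` in direction `j`. -/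
noncomputable def dirDiff {d : ℕ} (m : ℕ) (h : ℝ) (j : Fin d) (f : (Fin d → ℝ) → ℂ) :
    (Fin d → ℝ) → ℂ :=
  fun x => ∑ l ∈ Finset.range (m + 1),
    (-1 : ℂ) ^ (m - l) * (m.choose l : ℂ) * f (Function.update x j (x j + l * h))

/-- The mixed difference `Δ_h^{m,e} f = ∏_{i ∈ e} Δ_{h_i,i}^m f`, of order `m` in each direction
`i ∈ e`. -/
noncomputable def mixedDiff {d : ℕ} (m : ℕ) (e : Finset (Fin d)) (h : Fin d → ℝ)
    (f : (Fin d → ℝ) → ℂ) : (Fin d → ℝ) → ℂ :=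
  coordComp (fun i g => if i ∈ e then dirDiff m (h i) i g else g) f

/-- The modulus of smoothness
`ω_m^e(f, t)_p = sup {‖Δ_h^{m,e} f | L_p(ℝ^d)‖ : |h_i| < t_i for i ∈ e}`. -/
noncomputable def mixedModulus {d : ℕ} (m : ℕ) (e : Finset (Fin d)) (p : ℝ≥0∞)
    (f : (Fin d → ℝ) → ℂ) (t : Fin d → ℝ) : ℝ≥0∞ :=
  ⨆ (h : Fin d → ℝ) (_ : ∀ i ∈ e, |h i| < t i), eLpNorm (mixedDiff m e h f) p volume

/-- The `ℓ_p` norm of a family of extended non-negative numbers, `1 ≤ p ≤ ∞`. -/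
noncomputable def lpSum {ι : Type*} (p : ℝ≥0∞) (a : ι → ℝ≥0∞) : ℝ≥0∞ :=
  if p = ⊤ then ⨆ k, a k else (∑' k, a k ^ p.toReal) ^ (1 / p.toReal)

/-- The norm of `S^r_{p,p} B(ℝ^d)`:
`∑_{e ⊆ [d]} (∑_{k ∈ ℕ₀^d(e)} (2^{r |k|_1} ω_m^e(f, 2^{-k})_p)^p)^{1/p}`,
where `m` is the natural number with `m - 1 ≤ r < m`. -/
noncomputable def besovMixNorm {d : ℕ} (r : ℝ) (p : ℝ≥0∞) (f : (Fin d → ℝ) → ℂ) : ℝ≥0∞ :=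
  ∑ e : Finset (Fin d),
    lpSum p (fun k : {k : Fin d → ℕ // ∀ i, i ∉ e → k i = 0} =>
      (2 : ℝ≥0∞) ^ (r * ∑ i, (k.1 i : ℝ)) *
        mixedModulus (⌊r⌋₊ + 1) e p f (fun i => (2 : ℝ) ^ (-(k.1 i : ℝ))))

/-- Membership in the Besov space of dominating mixed smoothness `S^r_{p,p} B(ℝ^d)`. -/
def MemBesovMix {d : ℕ} (r : ℝ) (p : ℝ≥0∞) (f : (Fin d → ℝ) → ℂ) : Prop :=
  MemLp f p volume ∧ besovMixNorm r p f < ⊤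

end Besov

section Cube

/-- The unit cube `Ω = [0,1]^d`. -/
def cube (d : ℕ) : Set (Fin d → ℝ) := Set.Icc 0 1

/-- `f` agrees almost everywhere on the cube with some function in `S^m_p W(ℝ^d)`; only the values
of `f` on the cube matter. -/
def MemSobolevMixCube {d : ℕ} (m : ℕ) (p : ℝ≥0∞) (f : (Fin d → ℝ) → ℂ) : Prop :=
  ∃ g, MemSobolevMix m p g ∧ g =ᵐ[volume.restrict (cube d)] f

/-- The quotient norm of `S^m_p W(Ω)`; it is `∞` if `f` is not in this space. -/
noncomputable def sobolevMixCubeNorm {d : ℕ} (m : ℕ) (p : ℝ≥0∞) (f : (Fin d → ℝ) → ℂ) : ℝ≥0∞ :=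
  ⨅ (g : (Fin d → ℝ) → ℂ) (_ : MemSobolevMix m p g ∧ g =ᵐ[volume.restrict (cube d)] f),
    sobolevMixNorm m p g

/-- `f` agrees almost everywhere on the cube with some function in `S^r_{p,p} B(ℝ^d)`; only the
values of `f` on the cube matter. -/
def MemBesovMixCube {d : ℕ} (r : ℝ) (p : ℝ≥0∞) (f : (Fin d → ℝ) → ℂ) : Prop :=
  ∃ g, MemBesovMix r p g ∧ g =ᵐ[volume.restrict (cube d)] f

/-- The quotient norm of `S^r_{p,p} B(Ω)`; it is `∞` if `f` is not in this space. -/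
noncomputable def besovMixCubeNorm {d : ℕ} (r : ℝ) (p : ℝ≥0∞) (f : (Fin d → ℝ) → ℂ) : ℝ≥0∞ :=
  ⨅ (g : (Fin d → ℝ) → ℂ) (_ : MemBesovMix r p g ∧ g =ᵐ[volume.restrict (cube d)] f),
    besovMixNorm r p g

/-- The norm of `L_∞(Ω)`. -/
noncomputable def supCubeNorm {d : ℕ} (f : (Fin d → ℝ) → ℂ) : ℝ≥0∞ :=
  eLpNorm f ⊤ (volume.restrict (cube d))

end Cube

end DominatingMixed

/-! Both estimates fail on plane waves. Pick two different directions `i`, `j` and put f(x) = exp(i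
n x_i), g(x) = exp(i n x_j), with n a large power of two. All these functions, and the product exp(i
n (x_i + x_j)), have modulus one. A dominating mixed norm multiplies the costs of oscillation in
different directions: each factor costs about n^m, the product n^(2m). The right-hand side of the
estimate therefore grows like n^m and the left-hand side like n^(2m), which no constant can repair.
In the Besov case, f and g are only bounded by n^s with some s > r, which is enough as long as s <
2r.

Upper bounds need one good extension: the wave times a tensor product cutoff. Derivatives and
differences of a tensor product factor, so one-dimensional estimates suffice
(`exists_sobolevMixCubeNorm_wave_le`, `exists_besovMixCubeNorm_wave_le`).

Lower bounds must hold for every extension G and may use only its values on the cube. In the Besov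
case a mixed difference with step π/n multiplies the wave by a power of -2 and, on a smaller cube,
sees G only inside the unit cube (`exists_le_besovMixCubeNorm_wave`). In the Sobolev case the weak
derivative is tested against a bump supported in the cube times the real or imaginary part of the
wave (`exists_le_weakDerivNorm`, `exists_le_sobolevMixCubeNorm_wave`). -/

namespace DominatingMixed

/-! ### Differences and derivatives of modulated functions on the line -/

section OneDim

/-- The `m`-th order difference of a function of one real variable. -/
noncomputable def lineDiff (m : ℕ) (h : ℝ) (g : ℝ → ℂ) : ℝ → ℂ :=
  fun t => ∑ l ∈ Finset.range (m + 1), (-1 : ℂ) ^ (m - l) * (m.choose l : ℂ) * g (t + l * h)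

lemma lineDiff_eq_fwdDiff (m : ℕ) (h : ℝ) (g : ℝ → ℂ) :
    lineDiff m h g = (fwdDiff h)^[m] g := by
  funext t
  rw [fwdDiff_iter_eq_sum_shift, lineDiff]
  refine Finset.sum_congr rfl fun l _ => ?_
  simp [zsmul_eq_mul, nsmul_eq_mul]

lemma lineDiff_succ (m : ℕ) (h : ℝ) (g : ℝ → ℂ) (t : ℝ) :
    lineDiff (m + 1) h g t = lineDiff m h g (t + h) - lineDiff m h g t := by
  simp only [lineDiff_eq_fwdDiff, Function.iterate_succ_apply', fwdDiff]

lemma hasDerivAt_lineDiff (m : ℕ) (h : ℝ) {g : ℝ → ℂ} (hg : Differentiable ℝ g) (t : ℝ) :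
    HasDerivAt (lineDiff m h g) (lineDiff m h (deriv g) t) t := by
  unfold lineDiff
  refine HasDerivAt.fun_sum fun l _ => ?_
  exact ((hg (t + l * h)).hasDerivAt.comp_add_const t (l * h)).const_mul _

/-- Induction by the mean value inequality: the difference of order m + 1 is the increment over [t,
t + h] of the m-th difference of g, whose derivative is the m-th difference of g'. -/
lemma norm_lineDiff_le_of_iteratedDeriv (m : ℕ) (h B : ℝ) {g : ℝ → ℂ} (hg : ContDiff ℝ ∞ g)
    (hB : ∀ t, ‖iteratedDeriv m g t‖ ≤ B) (t : ℝ) : ‖lineDiff m h g t‖ ≤ |h| ^ m * B := by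
  induction m generalizing g t with
  | zero => simpa [lineDiff] using hB t
  | succ m ih =>
    have hd : Differentiable ℝ g := hg.differentiable (by simp)
    have hg' : ContDiff ℝ ∞ (deriv g) := by
      exact (contDiff_infty_iff_deriv.1 hg).2
    have h1 : ∀ t, ‖lineDiff m h (deriv g) t‖ ≤ |h| ^ m * B := fun t =>
      ih hg' (fun t => by rw [← iteratedDeriv_succ']; exact hB t) t
    have h2 := Convex.norm_image_sub_le_of_norm_hasDerivWithin_le (s := Set.univ)
      (f := lineDiff m h g) (f' := lineDiff m h (deriv g)) (x := t) (y := t + h)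
      (fun x _ => (hasDerivAt_lineDiff m h hd x).hasDerivWithinAt) (fun x _ => h1 x)
      convex_univ trivial trivial
    rw [lineDiff_succ]
    refine h2.trans (le_of_eq ?_)
    rw [add_sub_cancel_left, Real.norm_eq_abs, pow_succ]
    ring

lemma norm_lineDiff_le_of_norm_le (m : ℕ) (h B : ℝ) {g : ℝ → ℂ} (hB : ∀ t, ‖g t‖ ≤ B) (t : ℝ) :
    ‖lineDiff m h g t‖ ≤ 2 ^ m * B := by
  induction m generalizing t with
  | zero => simpa [lineDiff] using hB t
  | succ m ih =>
    rw [lineDiff_succ]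
    refine (norm_sub_le _ _).trans ?_
    have := ih (t + h)
    have := ih t
    rw [pow_succ]
    linarith

lemma lineDiff_eq_zero (m : ℕ) {h R : ℝ} (hh : |h| ≤ 1) {g : ℝ → ℂ}
    (hg : ∀ t, R < |t| → g t = 0) {t : ℝ} (ht : R + m < |t|) : lineDiff m h g t = 0 := by
  refine Finset.sum_eq_zero fun l hl => ?_
  rw [hg, mul_zero]
  have hl' : (l : ℝ) ≤ m := by exact_mod_cast Nat.lt_succ_iff.1 (Finset.mem_range.1 hl)
  have h1 : |(l : ℝ) * h| ≤ m := by
    rw [abs_mul, Nat.abs_cast]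
    nlinarith [abs_nonneg h, Nat.cast_nonneg (α := ℝ) l]
  have h2 := abs_sub_abs_le_abs_sub t (-(l * h))
  rw [abs_neg, sub_neg_eq_add] at h2
  linarith

/-- The modulated function `t ↦ ψ(t) e^{iνt}`. -/
noncomputable def modulate (ψ : ℝ → ℂ) (ν : ℝ) : ℝ → ℂ :=
  fun t => ψ t * Complex.exp (ν * t * Complex.I)

lemma norm_exp_real_mul_I (ν t : ℝ) : ‖Complex.exp (ν * t * Complex.I)‖ = 1 := by
  rw [← Complex.ofReal_mul, Complex.norm_exp_ofReal_mul_I]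

lemma norm_modulate (ψ : ℝ → ℂ) (ν t : ℝ) : ‖modulate ψ ν t‖ = ‖ψ t‖ := by
  rw [modulate, norm_mul, norm_exp_real_mul_I, mul_one]

lemma contDiff_modulate {ψ : ℝ → ℂ} (hψ : ContDiff ℝ ∞ ψ) (ν : ℝ) :
    ContDiff ℝ ∞ (modulate ψ ν) := by
  unfold modulate
  have : ContDiff ℝ ∞ (fun t : ℝ => (t : ℂ)) := Complex.ofRealCLM.contDiff
  exact hψ.mul ((contDiff_const.mul this).mul contDiff_const).cexp

lemma deriv_modulate {ψ : ℝ → ℂ} (hψ : Differentiable ℝ ψ) (ν : ℝ) :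
    deriv (modulate ψ ν) = modulate (deriv ψ) ν + (ν * Complex.I) • modulate ψ ν := by
  funext t
  have h1 : HasDerivAt (fun t : ℝ => (ν : ℂ) * t * Complex.I) (ν * Complex.I) t := by
    simpa using (((hasDerivAt_id t).ofReal_comp).const_mul (ν : ℂ)).mul_const Complex.I
  have := (hψ t).hasDerivAt.mul h1.cexp
  refine this.deriv.trans ?_
  simp [modulate]
  ring

lemma exists_bound_of_compactSupport {ψ : ℝ → ℂ} (hψ : Continuous ψ) (hc : HasCompactSupport ψ) :
    ∃ C : ℝ, 0 ≤ C ∧ ∀ t, ‖ψ t‖ ≤ C := by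
  obtain ⟨C, hC⟩ := hc.exists_bound_of_continuous hψ
  exact ⟨C, (norm_nonneg _).trans (hC 0), hC⟩

/-- A derivative either falls on ψ, giving another smooth compactly supported amplitude, or produces
a factor iν. The induction therefore runs over all amplitudes at once, and C is uniform in ν. -/
lemma exists_norm_iteratedDeriv_modulate_le (k : ℕ) {ψ : ℝ → ℂ} (hψ : ContDiff ℝ ∞ ψ)
    (hc : HasCompactSupport ψ) :
    ∃ C : ℝ, 0 ≤ C ∧ ∀ ν t, ‖iteratedDeriv k (modulate ψ ν) t‖ ≤ C * (1 + |ν|) ^ k := by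
  induction k generalizing ψ with
  | zero =>
    obtain ⟨C, hC, h⟩ := exists_bound_of_compactSupport hψ.continuous hc
    exact ⟨C, hC, fun ν t => by simpa [norm_modulate] using h t⟩
  | succ k ih =>
    have hψ' : ContDiff ℝ ∞ (deriv ψ) := (contDiff_infty_iff_deriv.1 hψ).2
    obtain ⟨C₁, hC₁, h₁⟩ := ih hψ' hc.deriv
    obtain ⟨C₂, hC₂, h₂⟩ := ih hψ hc
    refine ⟨C₁ + C₂, add_nonneg hC₁ hC₂, fun ν t => ?_⟩
    have hsm : ∀ {χ : ℝ → ℂ}, ContDiff ℝ ∞ χ → ContDiffAt ℝ k (modulate χ ν) t := fun h =>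
      ((contDiff_modulate h ν).of_le (by exact_mod_cast le_top)).contDiffAt
    rw [iteratedDeriv_succ', deriv_modulate (hψ.differentiable (by simp)),
      iteratedDeriv_add (g := (ν * Complex.I) • modulate ψ ν) (hsm hψ')
        ((hsm hψ).const_smul (ν * Complex.I)),
      iteratedDeriv_const_smul_field]
    refine (norm_add_le _ _).trans ?_
    rw [norm_smul, norm_mul, Complex.norm_I, mul_one, Complex.norm_real, Real.norm_eq_abs]
    have hν := abs_nonneg ν
    have hpow : 0 ≤ (1 + |ν|) ^ k := by positivity
    calc _ ≤ C₁ * (1 + |ν|) ^ k + |ν| * (C₂ * (1 + |ν|) ^ k) := by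
          gcongr
          exacts [h₁ ν t, h₂ ν t]
      _ ≤ _ := by
          rw [pow_succ]
          nlinarith [mul_nonneg hC₁ hpow, mul_nonneg hC₂ hpow,
            mul_nonneg (mul_nonneg hC₁ hpow) hν]

/-- With x = (1 + |ν|)|h|, the derivative bound gives x^m and the trivial bound gives a constant;
min(x^m, 1) ≤ x^s because 0 < s ≤ m. The free exponent s is later taken above r to make the Besov
sums converge. -/
lemma exists_norm_lineDiff_modulate_le {m : ℕ} {s : ℝ} (hs : 0 < s) (hsm : s ≤ m) {ψ : ℝ → ℂ}
    (hψ : ContDiff ℝ ∞ ψ) (hc : HasCompactSupport ψ) :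
    ∃ C : ℝ, 0 ≤ C ∧ ∀ ν h t, ‖lineDiff m h (modulate ψ ν) t‖ ≤ C * ((1 + |ν|) * |h|) ^ s := by
  obtain ⟨C₁, hC₁, h₁⟩ := exists_norm_iteratedDeriv_modulate_le m hψ hc
  obtain ⟨C₂, hC₂, h₂⟩ := exists_bound_of_compactSupport hψ.continuous hc
  refine ⟨C₁ + 2 ^ m * C₂, by positivity, fun ν h t => ?_⟩
  have hx : 0 ≤ (1 + |ν|) * |h| := by positivity
  set x := (1 + |ν|) * |h| with hxd
  rcases le_total x 1 with hx1 | hx1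
  · have := norm_lineDiff_le_of_iteratedDeriv m h _ (contDiff_modulate hψ ν) (h₁ ν) t
    have h3 : x ^ m ≤ x ^ s := by
      rcases hx.eq_or_lt with h0 | h0
      · rw [← h0, Real.zero_rpow hs.ne', zero_pow]
        rintro rfl
        simp at hsm
        linarith
      · rw [← Real.rpow_natCast]
        exact Real.rpow_le_rpow_of_exponent_ge h0 hx1 hsm
    calc _ ≤ |h| ^ m * (C₁ * (1 + |ν|) ^ m) := this
      _ = C₁ * x ^ m := by rw [hxd, mul_pow]; ring
      _ ≤ (C₁ + 2 ^ m * C₂) * x ^ s := by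
          gcongr
          have : 0 ≤ 2 ^ m * C₂ := by positivity
          linarith
  · have := norm_lineDiff_le_of_norm_le m h C₂ (g := modulate ψ ν)
      (fun t => by rw [norm_modulate]; exact h₂ t) t
    have h3 : 1 ≤ x ^ s := Real.one_le_rpow hx1 hs.le
    have : 0 ≤ 2 ^ m * C₂ := by positivity
    nlinarith

lemma lineDiff_exp (m : ℕ) (h ν t : ℝ) :
    lineDiff m h (fun t : ℝ => Complex.exp (ν * t * Complex.I)) t =
      (Complex.exp (ν * h * Complex.I) - 1) ^ m * Complex.exp (ν * t * Complex.I) := by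
  induction m generalizing t with
  | zero => simp [lineDiff]
  | succ m ih =>
    rw [lineDiff_succ, ih, ih]
    have : Complex.exp (ν * (t + h : ℝ) * Complex.I) =
        Complex.exp (ν * h * Complex.I) * Complex.exp (ν * t * Complex.I) := by
      rw [← Complex.exp_add]
      congr 1
      push_cast
      ring
    rw [this]
    ring

/-- There is a smooth cutoff function that equals one on `[0,1]`. -/
lemma exists_cutoff : ∃ ψ : ℝ → ℂ, ContDiff ℝ ∞ ψ ∧ HasCompactSupport ψ ∧
    ∀ t ∈ Set.Icc (0 : ℝ) 1, ψ t = 1 := by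
  let b : ContDiffBump (0 : ℝ) := ⟨1, 2, one_pos, one_lt_two⟩
  refine ⟨fun t => (b t : ℂ), Complex.ofRealCLM.contDiff.comp b.contDiff,
    b.hasCompactSupport.comp_left (g := fun t : ℝ => (t : ℂ)) (by simp), fun t ht => ?_⟩
  refine (congrArg Complex.ofReal (b.one_of_mem_closedBall ?_)).trans Complex.ofReal_one
  rw [mem_closedBall_zero_iff, Real.norm_eq_abs, abs_le]
  exact ⟨by linarith [ht.1], ht.2⟩

end OneDim

end DominatingMixed

namespace DominatingMixed

/-! ### Tensor products, plane waves and their cutoffs -/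

section Tensor

variable {d : ℕ}

/-- The tensor product of functions of one real variable. -/
noncomputable def tensor (a : Fin d → ℝ → ℂ) : (Fin d → ℝ) → ℂ := fun x => ∏ i, a i (x i)

/-- The plane wave `x ↦ e^{i⟨ν, x⟩}`. -/
noncomputable def wave (ν : Fin d → ℝ) : (Fin d → ℝ) → ℂ :=
  tensor fun i t => Complex.exp (ν i * t * Complex.I)

/-- The plane wave with frequency `ν`, localized by a tensor product cutoff function. -/
noncomputable def cutWave (ψ : ℝ → ℂ) (ν : Fin d → ℝ) : (Fin d → ℝ) → ℂ :=
  tensor fun i => modulate ψ (ν i)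

lemma norm_wave (ν x : Fin d → ℝ) : ‖wave ν x‖ = 1 := by
  simp [wave, tensor, norm_prod, norm_exp_real_mul_I]

lemma wave_mul_wave (ν μ : Fin d → ℝ) : (fun x => wave ν x * wave μ x) = wave (ν + μ) := by
  funext x
  simp only [wave, tensor, ← Finset.prod_mul_distrib, ← Complex.exp_add]
  refine Finset.prod_congr rfl fun i _ => ?_
  congr 1
  push_cast [Pi.add_apply]
  ring

lemma contDiff_tensor {a : Fin d → ℝ → ℂ} (ha : ∀ i, ContDiff ℝ ∞ (a i)) :
    ContDiff ℝ ∞ (tensor a) :=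
  contDiff_prod fun i _ => (ha i).comp (contDiff_apply ℝ ℝ i)

lemma contDiff_expLine (ν : ℝ) :
    ContDiff ℝ ∞ (fun t : ℝ => Complex.exp (ν * t * Complex.I)) := by
  have h : ContDiff ℝ ∞ (fun t : ℝ => (t : ℂ)) := Complex.ofRealCLM.contDiff
  exact ((contDiff_const.mul h).mul contDiff_const).cexp

lemma contDiff_wave (ν : Fin d → ℝ) : ContDiff ℝ ∞ (wave ν) :=
  contDiff_tensor fun i => contDiff_expLine (ν i)

lemma exists_zero_outside {ψ : ℝ → ℂ} (hc : HasCompactSupport ψ) :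
    ∃ R : ℝ, 0 ≤ R ∧ ∀ t, R < |t| → ψ t = 0 := by
  obtain ⟨R, hR, h⟩ := hc.exists_pos_le_norm
  exact ⟨R, hR.le, fun t ht => h t ht.le⟩

lemma tensor_eq_zero {a : Fin d → ℝ → ℂ} {R : ℝ} (ha : ∀ i t, R < |t| → a i t = 0)
    {x : Fin d → ℝ} (hx : x ∉ Set.Icc (fun _ => -R) (fun _ => R)) : tensor a x = 0 := by
  simp only [← Set.pi_univ_Icc, Set.mem_pi, Set.mem_univ, true_imp_iff, Set.mem_Icc,
    ← abs_le, not_forall, not_le] at hx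
  obtain ⟨i, hi⟩ := hx
  exact Finset.prod_eq_zero (Finset.mem_univ i) (ha i _ hi)

lemma modulate_eq_zero {ψ : ℝ → ℂ} {R : ℝ} (h : ∀ t, R < |t| → ψ t = 0) (ν t : ℝ) (ht : R < |t|) :
    modulate ψ ν t = 0 := by
  rw [modulate, h t ht, zero_mul]

lemma memLp_tensor {a : Fin d → ℝ → ℂ} (ha : ∀ i, Continuous (a i))
    {R : ℝ} (hR : ∀ i t, R < |t| → a i t = 0) (p : ℝ≥0∞) : MemLp (tensor a) p volume := by
  have hcont : Continuous (tensor a) :=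
    continuous_finsetProd _ fun i _ => (ha i).comp (continuous_apply i)
  exact hcont.memLp_of_hasCompactSupport
    (HasCompactSupport.intro (K := Set.Icc (fun _ => -R) (fun _ => R)) isCompact_Icc
      fun x hx => tensor_eq_zero hR hx)

/-- Sup bound times a power of the volume of a box containing the support. For `p = ⊤` the exponent
`p.toReal⁻¹` is 0, so the volume factor is 1. -/
lemma eLpNorm_tensor_le {a : Fin d → ℝ → ℂ} {R : ℝ} (hR : ∀ i t, R < |t| → a i t = 0)
    {B : Fin d → ℝ} (hB : ∀ i t, ‖a i t‖ ≤ B i) (p : ℝ≥0∞) :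
    eLpNorm (tensor a) p volume ≤
      volume (Set.Icc (fun _ : Fin d => -R) (fun _ => R)) ^ p.toReal⁻¹ *
        ENNReal.ofReal (∏ i, B i) := by
  have hsub : Function.support (tensor a) ⊆ Set.Icc (fun _ => -R) (fun _ => R) := by
    intro x hx
    by_contra hx'
    exact hx (tensor_eq_zero hR hx')
  rw [← eLpNorm_restrict_eq_of_support_subset hsub]
  refine (eLpNorm_le_of_ae_bound (C := ∏ i, B i) (ae_of_all _ fun x => ?_)).trans (le_of_eq ?_)
  · rw [tensor, norm_prod]
    exact Finset.prod_le_prod (fun _ _ => norm_nonneg _) fun i _ => hB i _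
  · rw [Measure.restrict_apply_univ]

lemma cutWave_eq_wave {ψ : ℝ → ℂ} (hψ : ∀ t ∈ Set.Icc (0 : ℝ) 1, ψ t = 1) (ν : Fin d → ℝ)
    {x : Fin d → ℝ} (hx : x ∈ cube d) : cutWave ψ ν x = wave ν x := by
  simp only [cutWave, wave, tensor]
  refine Finset.prod_congr rfl fun i _ => ?_
  rw [modulate, hψ _ ⟨hx.1 i, hx.2 i⟩, one_mul]

lemma cutWave_ae_eq_wave {ψ : ℝ → ℂ} (hψ : ∀ t ∈ Set.Icc (0 : ℝ) 1, ψ t = 1) (ν : Fin d → ℝ) :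
    cutWave ψ ν =ᵐ[volume.restrict (cube d)] wave ν :=
  (ae_restrict_iff' measurableSet_Icc).2 (ae_of_all _ fun _ hx => cutWave_eq_wave hψ ν hx)

lemma volume_cube : volume (cube d) = 1 := by
  rw [cube, Real.volume_Icc_pi]
  simp

lemma supCubeNorm_wave_le (ν : Fin d → ℝ) : supCubeNorm (wave ν) ≤ 1 := by
  refine (eLpNorm_le_of_ae_bound (C := 1) (ae_of_all _ fun x => (norm_wave ν x).le)).trans ?_
  simp

lemma memLp_top_wave (ν : Fin d → ℝ) : MemLp (wave ν) ⊤ (volume.restrict (cube d)) :=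
  ⟨(contDiff_wave ν).continuous.aestronglyMeasurable,
    (supCubeNorm_wave_le ν).trans_lt ENNReal.one_lt_top⟩

end Tensor

/-! ### Mixed differences of tensor products, and their locality -/

section Differences

variable {d : ℕ}

lemma tensor_update_fun (a : Fin d → ℝ → ℂ) (j : Fin d) (g : ℝ → ℂ) (x : Fin d → ℝ) :
    tensor (Function.update a j g) x = g (x j) * ∏ i ∈ Finset.univ.erase j, a i (x i) := by
  rw [tensor, ← Finset.mul_prod_erase _ _ (Finset.mem_univ j), Function.update_self]
  congr 1
  refine Finset.prod_congr rfl fun i hi => ?_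
  rw [Function.update_of_ne (Finset.ne_of_mem_erase hi)]

lemma tensor_update_point (a : Fin d → ℝ → ℂ) (j : Fin d) (t : ℝ) (x : Fin d → ℝ) :
    tensor a (Function.update x j t) = a j t * ∏ i ∈ Finset.univ.erase j, a i (x i) := by
  rw [tensor, ← Finset.mul_prod_erase _ _ (Finset.mem_univ j), Function.update_self]
  congr 1
  refine Finset.prod_congr rfl fun i hi => ?_
  rw [Function.update_of_ne (Finset.ne_of_mem_erase hi)]

lemma dirDiff_tensor (m : ℕ) (h : ℝ) (j : Fin d) (a : Fin d → ℝ → ℂ) :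
    dirDiff m h j (tensor a) = tensor (Function.update a j (lineDiff m h (a j))) := by
  funext x
  simp only [dirDiff, tensor_update_fun, tensor_update_point, lineDiff, Finset.sum_mul, mul_assoc]

/-- Each one-directional difference changes only its own factor. The induction is over
duplicate-free lists, so that no factor is differenced twice. -/
lemma mixedDiff_tensor (m : ℕ) (e : Finset (Fin d)) (h : Fin d → ℝ) (a : Fin d → ℝ → ℂ) :
    mixedDiff m e h (tensor a) =
      tensor fun i => if i ∈ e then lineDiff m (h i) (a i) else a i := by
  have key : ∀ L : List (Fin d), L.Nodup →
      L.foldr (fun i g => if i ∈ e then dirDiff m (h i) i g else g) (tensor a) =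
        tensor fun i => if i ∈ L ∧ i ∈ e then lineDiff m (h i) (a i) else a i := by
    intro L hL
    induction L with
    | nil => simp
    | cons j L ih =>
      obtain ⟨hj, hL⟩ := List.nodup_cons.1 hL
      rw [List.foldr_cons, ih hL]
      by_cases hje : j ∈ e
      · rw [if_pos hje, dirDiff_tensor]
        congr 1
        funext i
        rcases eq_or_ne i j with rfl | hij
        · simp [hj, hje]
        · simp [hij]
      · rw [if_neg hje]
        congr 1
        funext i
        rcases eq_or_ne i j with rfl | hij
        · simp [hje]
        · simp [hij]
  simpa [mixedDiff, coordComp, List.mem_finRange] using key (List.finRange d) (List.nodup_finRange d)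

lemma mixedDiff_wave (m : ℕ) (e : Finset (Fin d)) (h ν : Fin d → ℝ) (x : Fin d → ℝ) :
    mixedDiff m e h (wave ν) x =
      (∏ i ∈ e, (Complex.exp (ν i * h i * Complex.I) - 1) ^ m) * wave ν x := by
  rw [wave, mixedDiff_tensor, tensor, tensor, ← Fintype.prod_ite_mem e,
    ← Finset.prod_mul_distrib]
  refine Finset.prod_congr rfl fun i _ => ?_
  split_ifs
  · rw [lineDiff_exp]
  · rw [one_mul]

lemma update_add_eq (x : Fin d → ℝ) (j : Fin d) (t : ℝ) :
    Function.update x j (x j + t) = x + Pi.single j t := by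
  funext i
  rcases eq_or_ne i j with rfl | hij
  · simp
  · simp [hij]

/-- For h ≥ 0 the difference at x uses only x and points up to mh further in direction j, so
lowering the upper corner of the box by δ ≥ mh keeps all of them in the original box. -/
lemma dirDiff_ae_congr {m : ℕ} {h δ t : ℝ} (hh : 0 ≤ h) (hδ : m * h ≤ δ) (j : Fin d)
    {F G : (Fin d → ℝ) → ℂ}
    (hFG : ∀ᵐ x, x ∈ Set.Icc (0 : Fin d → ℝ) (fun _ => t) → F x = G x) :
    ∀ᵐ x, x ∈ Set.Icc (0 : Fin d → ℝ) (fun _ => t - δ) →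
      dirDiff m h j F x = dirDiff m h j G x := by
  -- Translations preserve null sets, so the almost everywhere equality survives each of the shifts.
  have h1 : ∀ l : ℕ, ∀ᵐ x : Fin d → ℝ,
      x + Pi.single j (l * h) ∈ Set.Icc (0 : Fin d → ℝ) (fun _ => t) →
        F (x + Pi.single j (l * h)) = G (x + Pi.single j (l * h)) := fun l =>
    (measurePreserving_add_right volume _).quasiMeasurePreserving.ae hFG
  filter_upwards [ae_all_iff.2 h1] with x hx hxt
  refine Finset.sum_congr rfl fun l hl => ?_
  rw [update_add_eq, hx l]
  have hl' : (l : ℝ) ≤ m := by exact_mod_cast Nat.lt_succ_iff.1 (Finset.mem_range.1 hl)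
  have h2 : 0 ≤ (l : ℝ) * h := by positivity
  have h3 : (l : ℝ) * h ≤ m * h := by gcongr
  constructor
  · intro i
    have := hxt.1 i
    rcases eq_or_ne i j with rfl | hij
    · simpa using add_nonneg this h2
    · simpa [hij] using this
  · intro i
    have := hxt.2 i
    rcases eq_or_ne i j with rfl | hij
    · simp at this ⊢
      linarith
    · simp [hij] at this ⊢
      linarith [mul_nonneg (Nat.cast_nonneg (α := ℝ) m) hh]

lemma mixedDiff_ae_congr {m : ℕ} {h : Fin d → ℝ} {δ t : ℝ} (hh : ∀ i, 0 ≤ h i) (hδ₀ : 0 ≤ δ)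
    (hδ : ∀ i, m * h i ≤ δ) (e : Finset (Fin d)) {F G : (Fin d → ℝ) → ℂ}
    (hFG : ∀ᵐ x, x ∈ Set.Icc (0 : Fin d → ℝ) (fun _ => t) → F x = G x) :
    ∀ᵐ x, x ∈ Set.Icc (0 : Fin d → ℝ) (fun _ => t - d * δ) →
      mixedDiff m e h F x = mixedDiff m e h G x := by
  have key : ∀ L : List (Fin d),
      ∀ᵐ x, x ∈ Set.Icc (0 : Fin d → ℝ) (fun _ => t - L.length * δ) →
        L.foldr (fun i g => if i ∈ e then dirDiff m (h i) i g else g) F x =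
          L.foldr (fun i g => if i ∈ e then dirDiff m (h i) i g else g) G x := by
    intro L
    induction L with
    | nil => simpa using hFG
    | cons j L ih =>
      rw [List.foldr_cons, List.foldr_cons, List.length_cons]
      have hlen : t - ((L.length + 1 : ℕ) : ℝ) * δ = t - L.length * δ - δ := by
        push_cast
        ring
      rw [hlen]
      by_cases hj : j ∈ e
      · rw [if_pos hj, if_pos hj]
        exact dirDiff_ae_congr (hh j) (hδ j) j ih
      · rw [if_neg hj, if_neg hj]
        filter_upwards [ih] with x hx hxt
        exact hx ⟨hxt.1, fun i => (hxt.2 i).trans (sub_le_self _ hδ₀)⟩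
  simpa [mixedDiff, coordComp] using key (List.finRange d)

end Differences

end DominatingMixed

namespace DominatingMixed

/-! ### Weighted sequence norms of geometric families -/

section SequenceSums

lemma tsum_prod_geometric (d : ℕ) (ρ : ℝ≥0∞) :
    ∑' k : Fin d → ℕ, ∏ i, ρ ^ k i = ((1 - ρ)⁻¹) ^ d := by
  induction d with
  | zero => simp
  | succ d ih =>
    rw [← (Fin.consEquiv fun _ : Fin (d + 1) => ℕ).tsum_eq, ENNReal.tsum_prod']
    simp only [Fin.consEquiv_apply, Fin.prod_univ_succ, Fin.cons_zero, Fin.cons_succ,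
      ENNReal.tsum_mul_left, ih, ENNReal.tsum_mul_right, ENNReal.tsum_geometric]
    rw [pow_succ']

lemma lpSum_mono {ι : Type*} (p : ℝ≥0∞) {a b : ι → ℝ≥0∞} (h : ∀ k, a k ≤ b k) :
    lpSum p a ≤ lpSum p b := by
  unfold lpSum
  split_ifs
  · exact iSup_mono h
  · gcongr with k
    exact h k

lemma le_lpSum {ι : Type*} {p : ℝ≥0∞} (hp : p ≠ 0) (a : ι → ℝ≥0∞) (k : ι) : a k ≤ lpSum p a := by
  unfold lpSum
  split_ifs with h
  · exact le_iSup a k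
  · have hp' : 0 < p.toReal := ENNReal.toReal_pos hp h
    calc a k = (a k ^ p.toReal) ^ (1 / p.toReal) := by
          rw [← ENNReal.rpow_mul, mul_one_div_cancel hp'.ne', ENNReal.rpow_one]
      _ ≤ _ := by
          gcongr
          exact ENNReal.le_tsum k

/-- The sum over all of ℕ^d factors into d geometric series and dominates the sum over any
subfamily. Hence one M serves all index sets occurring in the Besov norm. -/
lemma exists_lpSum_geometric_le {d : ℕ} {p : ℝ≥0∞} (hp : p ≠ 0) {ρ : ℝ≥0∞} (hρ : ρ < 1) :
    ∃ M : ℝ≥0∞, M ≠ ⊤ ∧ ∀ (P : (Fin d → ℕ) → Prop) (c : ℝ≥0∞),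
      lpSum p (fun k : {k : Fin d → ℕ // P k} => c * ∏ i, ρ ^ k.1 i) ≤ c * M := by
  by_cases h : p = ⊤
  · refine ⟨1, ENNReal.one_ne_top, fun P c => ?_⟩
    rw [lpSum, if_pos h]
    refine iSup_le fun k => ?_
    gcongr
    exact Finset.prod_le_one' fun i _ => pow_le_one' hρ.le _
  · have hp' : 0 < p.toReal := ENNReal.toReal_pos hp h
    have hσ : ρ ^ p.toReal < 1 := ENNReal.rpow_lt_one hρ hp'
    refine ⟨(((1 - ρ ^ p.toReal)⁻¹) ^ d) ^ (1 / p.toReal), ?_, fun P c => ?_⟩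
    · refine ENNReal.rpow_ne_top_of_nonneg (by positivity) (ENNReal.pow_ne_top ?_)
      exact ENNReal.inv_ne_top.2 (tsub_pos_of_lt hσ).ne'
    · rw [lpSum, if_neg h, ← tsum_prod_geometric]
      calc _ ≤ (∑' k : Fin d → ℕ, (c * ∏ i, ρ ^ k i) ^ p.toReal) ^ (1 / p.toReal) := by
            gcongr
            exact ENNReal.tsum_comp_le_tsum_of_injective Subtype.val_injective
              fun k : Fin d → ℕ => (c * ∏ i, ρ ^ k i) ^ p.toReal
        _ = _ := by
            simp only [ENNReal.mul_rpow_of_nonneg _ _ hp'.le,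
              ← ENNReal.prod_rpow_of_nonneg hp'.le, ENNReal.tsum_mul_left,
              ENNReal.mul_rpow_of_nonneg _ _ (one_div_nonneg.2 hp'.le)]
            rw [← ENNReal.rpow_mul, mul_one_div_cancel hp'.ne', ENNReal.rpow_one]
            simp only [← ENNReal.rpow_natCast, ← ENNReal.rpow_mul, mul_comm]

end SequenceSums

/-! ### Upper and lower Besov bounds for plane waves -/

section BesovBounds

variable {d : ℕ}

/-- The difference factors over the coordinates. In a direction outside e there is no difference,
but t_i = 1 and (1 + |ν_i|)^s ≥ 1, so the plain sup bound fits the same product formula. -/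
lemma exists_mixedModulus_cutWave_le (d : ℕ) {m : ℕ} {s : ℝ} (hs : 0 < s) (hsm : s ≤ m)
    {ψ : ℝ → ℂ} (hψ : ContDiff ℝ ∞ ψ) (hc : HasCompactSupport ψ) (p : ℝ≥0∞) :
    ∃ D : ℝ≥0∞, D ≠ ⊤ ∧ ∀ (ν : Fin d → ℝ) (e : Finset (Fin d)) (t : Fin d → ℝ),
      (∀ i, 0 < t i) → (∀ i, t i ≤ 1) → (∀ i, i ∉ e → t i = 1) →
      mixedModulus m e p (cutWave ψ ν) t ≤
        D * ENNReal.ofReal (∏ i, ((1 + |ν i|) * t i) ^ s) := by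
  obtain ⟨C₁, hC₁, h₁⟩ := exists_norm_lineDiff_modulate_le hs hsm hψ hc
  obtain ⟨C₂, hC₂, h₂⟩ := exists_bound_of_compactSupport hψ.continuous hc
  obtain ⟨R, hR, h₃⟩ := exists_zero_outside hc
  set K := C₁ + C₂ with hK
  set V := volume (Set.Icc (fun _ : Fin d => -(R + m)) (fun _ => R + m)) ^ p.toReal⁻¹ with hV
  refine ⟨V * ENNReal.ofReal (K ^ d), ENNReal.mul_ne_top ?_ ENNReal.ofReal_ne_top,
    fun ν e t ht₀ ht₁ hte => iSup₂_le fun h hh => ?_⟩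
  · exact ENNReal.rpow_ne_top_of_nonneg (by positivity) isCompact_Icc.measure_lt_top.ne
  rw [cutWave, mixedDiff_tensor]
  refine (eLpNorm_tensor_le (R := R + m) (B := fun i => K * ((1 + |ν i|) * t i) ^ s) ?_ ?_ p).trans
    ?_
  · intro i u hu
    have hm : (0 : ℝ) ≤ m := Nat.cast_nonneg m
    split_ifs with hi
    · exact lineDiff_eq_zero m ((hh i hi).le.trans (ht₁ i)) (modulate_eq_zero h₃ (ν i)) hu
    · exact modulate_eq_zero h₃ _ _ (by linarith)
  · intro i u
    have hν := abs_nonneg (ν i)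
    have hpos := ht₀ i
    split_ifs with hi
    · refine (h₁ (ν i) (h i) u).trans ?_
      have := (hh i hi).le
      gcongr
      linarith
    · rw [norm_modulate, hte i hi, mul_one]
      have : 1 ≤ (1 + |ν i|) ^ s := Real.one_le_rpow (by linarith) hs.le
      nlinarith [h₂ u]
  · rw [Finset.prod_mul_distrib, Finset.prod_const, Finset.card_univ, Fintype.card_fin,
      ENNReal.ofReal_mul (by positivity), mul_assoc]

/-- The weight 2^(r|k|₁) against the decay 2^(-s|k|₁) of the modulus leaves a geometric family with
ratio ρ = 2^(r - s) < 1; this is where s > r enters. -/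
lemma exists_besovMixNorm_cutWave_le (d : ℕ) {r s : ℝ} (hr : 0 < r) (hrs : r < s)
    (hs : s ≤ (⌊r⌋₊ + 1 : ℕ)) {p : ℝ≥0∞} (hp : p ≠ 0) {ψ : ℝ → ℂ} (hψ : ContDiff ℝ ∞ ψ)
    (hc : HasCompactSupport ψ) :
    ∃ D : ℝ≥0∞, D ≠ ⊤ ∧ ∀ ν : Fin d → ℝ,
      besovMixNorm r p (cutWave ψ ν) ≤ D * ENNReal.ofReal (∏ i, (1 + |ν i|) ^ s) := by
  obtain ⟨D, hD, hmod⟩ := exists_mixedModulus_cutWave_le d (hr.trans hrs) hs hψ hc p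
  set ρ : ℝ≥0∞ := 2 ^ (r - s) with hρ
  have hρ1 : ρ < 1 := ENNReal.rpow_lt_one_of_one_lt_of_neg (by norm_num) (by linarith)
  obtain ⟨M, hM, hsum⟩ := exists_lpSum_geometric_le (d := d) hp hρ1
  refine ⟨(Finset.univ : Finset (Finset (Fin d))).card • (D * M), ?_, fun ν => ?_⟩
  · rw [nsmul_eq_mul]
    exact ENNReal.mul_ne_top (ENNReal.natCast_ne_top _) (ENNReal.mul_ne_top hD hM)
  set N := ENNReal.ofReal (∏ i, (1 + |ν i|) ^ s) with hN
  rw [smul_mul_assoc]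
  refine Finset.sum_le_card_nsmul _ _ _ fun e _ => ?_
  refine (lpSum_mono p fun k => ?_).trans ((hsum _ (D * N)).trans (le_of_eq (by ring)))
  refine (mul_le_mul_right (hmod ν e _ (fun i => by positivity)
    (fun i => Real.rpow_le_one_of_one_le_of_nonpos one_le_two (by simp)) fun i hi => ?_) _).trans
    (le_of_eq ?_)
  · simp [k.2 i hi]
  · have h1 : ENNReal.ofReal (∏ i, ((1 + |ν i|) * (2 : ℝ) ^ (-(k.1 i : ℝ))) ^ s) =
        N * ∏ i, (2 : ℝ≥0∞) ^ (-(k.1 i : ℝ) * s) := by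
      rw [hN, ← Finset.prod_congr rfl fun i _ => (Real.mul_rpow (by positivity) (by positivity)).symm,
        Finset.prod_mul_distrib, ENNReal.ofReal_mul (by positivity)]
      congr 1
      rw [ENNReal.ofReal_prod_of_nonneg fun i _ => by positivity]
      refine Finset.prod_congr rfl fun i _ => ?_
      rw [← Real.rpow_mul zero_le_two, ← ENNReal.ofReal_rpow_of_pos zero_lt_two]
      simp
    have h2 : (2 : ℝ≥0∞) ^ (r * ∑ i, (k.1 i : ℝ)) = ∏ i, (2 : ℝ≥0∞) ^ (r * (k.1 i : ℝ)) := by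
      rw [Finset.mul_sum]
      induction (Finset.univ : Finset (Fin d)) using Finset.induction_on with
      | empty => simp
      | insert a u ha ih =>
        rw [Finset.sum_insert ha, Finset.prod_insert ha, ← ih,
          ENNReal.rpow_add _ _ two_ne_zero ENNReal.ofNat_ne_top]
    have h3 : ∏ i, ρ ^ k.1 i =
        (∏ i, (2 : ℝ≥0∞) ^ (r * (k.1 i : ℝ))) * ∏ i, (2 : ℝ≥0∞) ^ (-(k.1 i : ℝ) * s) := by
      rw [← Finset.prod_mul_distrib]
      refine Finset.prod_congr rfl fun i _ => ?_
      rw [← ENNReal.rpow_add _ _ two_ne_zero ENNReal.ofNat_ne_top, hρ, ← ENNReal.rpow_natCast,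
        ← ENNReal.rpow_mul]
      congr 1
      ring
    rw [h1, h2, h3]
    ring

lemma memBesovMix_cutWave {r : ℝ} (hr : 0 < r) {p : ℝ≥0∞} (hp : p ≠ 0) {ψ : ℝ → ℂ}
    (hψ : ContDiff ℝ ∞ ψ) (hc : HasCompactSupport ψ) (ν : Fin d → ℝ) :
    MemBesovMix r p (cutWave ψ ν) := by
  obtain ⟨R, hR, h₃⟩ := exists_zero_outside hc
  refine ⟨memLp_tensor (fun i => (contDiff_modulate hψ (ν i)).continuous)
    (fun i => modulate_eq_zero h₃ (ν i)) p, ?_⟩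
  obtain ⟨D, hD, h⟩ := exists_besovMixNorm_cutWave_le d hr
    (by simpa using Nat.lt_floor_add_one r) le_rfl hp hψ hc
  exact (h ν).trans_lt (ENNReal.mul_lt_top hD.lt_top ENNReal.ofReal_lt_top)

lemma memBesovMixCube_wave {r : ℝ} (hr : 0 < r) {p : ℝ≥0∞} (hp : p ≠ 0) (ν : Fin d → ℝ) :
    MemBesovMixCube r p (wave ν) := by
  obtain ⟨ψ, hψ, hc, h1⟩ := exists_cutoff
  exact ⟨_, memBesovMix_cutWave hr hp hψ hc ν, cutWave_ae_eq_wave h1 ν⟩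

lemma exists_besovMixCubeNorm_wave_le (d : ℕ) {r s : ℝ} (hr : 0 < r) (hrs : r < s)
    (hs : s ≤ (⌊r⌋₊ + 1 : ℕ)) {p : ℝ≥0∞} (hp : p ≠ 0) :
    ∃ D : ℝ≥0∞, D ≠ ⊤ ∧ ∀ ν : Fin d → ℝ,
      besovMixCubeNorm r p (wave ν) ≤ D * ENNReal.ofReal (∏ i, (1 + |ν i|) ^ s) := by
  obtain ⟨ψ, hψ, hc, h1⟩ := exists_cutoff
  obtain ⟨D, hD, h⟩ := exists_besovMixNorm_cutWave_le d hr hrs hs hp hψ hc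
  exact ⟨D, hD, fun ν => (iInf₂_le _
    ⟨memBesovMix_cutWave hr hp hψ hc ν, cutWave_ae_eq_wave h1 ν⟩).trans (h ν)⟩

/-- The frequency is `4 * 2 ^ j` in the directions of `e`; the mixed difference with step
`π / (4 * 2 ^ j)` multiplies the wave by `(-2) ^ (m * #e)`. -/
lemma exists_le_besovMixCubeNorm_wave {r : ℝ} {p : ℝ≥0∞} (hp : p ≠ 0) (e : Finset (Fin d)) :
    ∃ c : ℝ≥0∞, c ≠ 0 ∧ ∃ j₀ : ℕ, ∀ j : ℕ, j₀ ≤ j →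
      c * (2 : ℝ≥0∞) ^ (r * (e.card * j)) ≤
        besovMixCubeNorm r p (wave fun i => if i ∈ e then (4 * 2 ^ j : ℝ) else 0) := by
  set m := ⌊r⌋₊ + 1 with hm
  set Q := Set.Icc (0 : Fin d → ℝ) (fun _ => 1 / 2) with hQ
  have hvol : volume Q ≠ 0 := by
    rw [hQ, Real.volume_Icc_pi, Finset.prod_ne_zero_iff]
    intro i _
    norm_num
  refine ⟨volume Q ^ (1 / p.toReal), ?_, ?_⟩
  · rw [Ne, ENNReal.rpow_eq_zero_iff]
    rintro (⟨h, -⟩ | ⟨-, h⟩)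
    · exact hvol h
    · exact absurd h (not_lt.2 (by positivity))
  -- Since π < 4, the total shrinkage d·m·π/(4·2^j) is at most d·m/2^j, which is below 1/2 once 2^j
  -- > 2dm.
  obtain ⟨j₀, hj₀⟩ := pow_unbounded_of_one_lt (d * (m * 2) : ℝ) one_lt_two
  refine ⟨j₀, fun j hj => le_iInf₂ fun G hG => ?_⟩
  set n : ℝ := 4 * 2 ^ j with hn
  have hn0 : 0 < n := by positivity
  set ν : Fin d → ℝ := fun i => if i ∈ e then n else 0 with hν
  set h : Fin d → ℝ := fun _ => Real.pi / n with hh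
  -- The modulus admits only steps strictly below 2^(-j); the factor 4 in the frequency provides the
  -- room, as π < 4.
  have hstep : Real.pi / n < (2 : ℝ) ^ (-(j : ℝ)) := by
    rw [Real.rpow_neg zero_le_two, Real.rpow_natCast, div_lt_iff₀ hn0, hn,
      mul_comm (4 : ℝ), inv_mul_cancel_left₀ (by positivity)]
    linarith [Real.pi_lt_four]
  have hpow : (2 : ℝ) ^ j₀ ≤ 2 ^ j := pow_le_pow_right₀ one_le_two hj
  have hsmall : d * (m * (Real.pi / n)) ≤ 1 / 2 := by
    rw [← mul_div_assoc, ← mul_div_assoc, div_le_iff₀ hn0, hn]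
    have : (0 : ℝ) ≤ d * m := by positivity
    nlinarith [Real.pi_lt_four, Real.pi_pos]
  have hae : ∀ᵐ x, x ∈ Q → mixedDiff m e h G x = mixedDiff m e h (wave ν) x := by
    have h0 : ∀ᵐ x, x ∈ Set.Icc (0 : Fin d → ℝ) (fun _ => 1) → G x = wave ν x :=
      (ae_restrict_iff' measurableSet_Icc).1 hG.2
    have := mixedDiff_ae_congr (m := m) (h := h) (δ := m * (Real.pi / n))
      (fun i => by positivity) (by positivity) (fun i => le_rfl) e h0
    filter_upwards [this] with x hx hxQ
    exact hx ⟨hxQ.1, fun i => (hxQ.2 i).trans (by linarith)⟩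
  have hnorm : ∀ x, 1 ≤ ‖mixedDiff m e h (wave ν) x‖ := by
    intro x
    rw [mixedDiff_wave, norm_mul, norm_wave, mul_one, norm_prod]
    refine Finset.one_le_prod fun i hi => ?_
    have : Complex.exp (ν i * h i * Complex.I) = -1 := by
      rw [← Complex.exp_pi_mul_I, ← Complex.ofReal_mul]
      congr 3
      simp only [hν, hh, if_pos hi]
      field_simp
    rw [this, norm_pow]
    refine one_le_pow₀ ?_
    norm_num
  have hlow : volume Q ^ (1 / p.toReal) ≤ eLpNorm (mixedDiff m e h G) p volume := by
    calc volume Q ^ (1 / p.toReal)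
        = eLpNorm (fun _ : Fin d → ℝ => (1 : ℝ)) p (volume.restrict Q) := by
          rw [eLpNorm_const _ hp, Measure.restrict_apply_univ]
          · simp
          · rwa [Ne, Measure.restrict_eq_zero]
      _ ≤ eLpNorm (mixedDiff m e h G) p (volume.restrict Q) := by
          refine eLpNorm_mono_ae ?_
          filter_upwards [(ae_restrict_iff' measurableSet_Icc).2 hae] with x hx
          rw [hx, norm_one]
          exact hnorm x
      _ ≤ _ := eLpNorm_restrict_le _ _ _ _
  -- A single term of the norm suffices: the subset e with k = j on e, whose weight is 2^(r·#e·j).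
  let k : {k : Fin d → ℕ // ∀ i, i ∉ e → k i = 0} :=
    ⟨fun i => if i ∈ e then j else 0, fun i hi => if_neg hi⟩
  have hk : ∑ i, (k.1 i : ℝ) = e.card * j := by
    simp [k, Finset.sum_ite_mem]
  refine le_trans ?_ (Finset.single_le_sum (fun _ _ => zero_le) (Finset.mem_univ e))
  refine le_trans ?_ (le_lpSum hp _ k)
  rw [hk, mul_comm]
  gcongr
  refine hlow.trans (le_iSup₂_of_le h (fun i hi => ?_) le_rfl)
  simp only [k, hh, if_pos hi]
  rwa [abs_of_pos (by positivity)]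

end BesovBounds

end DominatingMixed

namespace DominatingMixed

/-! ### Weak derivatives of smooth tensor products -/

section IntegrationByParts

variable {d : ℕ}

/-- Smooth real functions supported in `K`. -/
structure IsTestOn (K : Set (Fin d → ℝ)) (φ : (Fin d → ℝ) → ℝ) : Prop where
  contDiff : ContDiff ℝ ∞ φ
  tsupport_subset : tsupport φ ⊆ K

lemma IsTestOn.hasCompactSupport {K : Set (Fin d → ℝ)} (hK : IsCompact K)
    {φ : (Fin d → ℝ) → ℝ} (h : IsTestOn K φ) : HasCompactSupport φ :=
  hK.of_isClosed_subset (isClosed_tsupport _) h.tsupport_subset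

lemma IsTestOn.eq_zero {K : Set (Fin d → ℝ)} {φ : (Fin d → ℝ) → ℝ} (h : IsTestOn K φ)
    {x : Fin d → ℝ} (hx : x ∉ K) : φ x = 0 :=
  image_eq_zero_of_notMem_tsupport fun hx' => hx (h.tsupport_subset hx')

lemma IsTestOn.partialDeriv {K : Set (Fin d → ℝ)} {φ : (Fin d → ℝ) → ℝ} (h : IsTestOn K φ)
    (i : Fin d) : IsTestOn K (partialDeriv i φ) :=
  ⟨(h.contDiff.fderiv_right (m := ∞) (by simp)).clm_apply contDiff_const,
    (tsupport_fderiv_apply_subset ℝ _).trans h.tsupport_subset⟩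

lemma IsTestOn.partialDeriv_iterate {K : Set (Fin d → ℝ)} {φ : (Fin d → ℝ) → ℝ}
    (h : IsTestOn K φ) (i : Fin d) (k : ℕ) :
    IsTestOn K ((DominatingMixed.partialDeriv i)^[k] φ) := by
  induction k with
  | zero => exact h
  | succ k ih =>
    rw [Function.iterate_succ_apply']
    exact ih.partialDeriv i

lemma IsTestOn.foldr {K : Set (Fin d → ℝ)} {φ : (Fin d → ℝ) → ℝ} (h : IsTestOn K φ)
    (α : Fin d → ℕ) (L : List (Fin d)) :
    IsTestOn K (L.foldr (fun i => (DominatingMixed.partialDeriv i)^[α i]) φ) := by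
  induction L with
  | nil => exact h
  | cons j L ih => exact ih.partialDeriv_iterate j _

lemma IsTestOn.multiDeriv {K : Set (Fin d → ℝ)} {φ : (Fin d → ℝ) → ℝ} (h : IsTestOn K φ)
    (α : Fin d → ℕ) : IsTestOn K (multiDeriv α φ) :=
  h.foldr α _

/-- The classical derivative of order `β` of `tensor a`. -/
noncomputable def tensorDeriv (a : Fin d → ℝ → ℂ) (β : Fin d → ℕ) : (Fin d → ℝ) → ℂ :=
  tensor fun i => iteratedDeriv (β i) (a i)

lemma contDiff_iteratedDeriv {g : ℝ → ℂ} (hg : ContDiff ℝ ∞ g) (k : ℕ) :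
    ContDiff ℝ ∞ (iteratedDeriv k g) := by
  rw [iteratedDeriv_eq_iterate]
  exact hg.iterate_deriv k

lemma contDiff_tensorDeriv {a : Fin d → ℝ → ℂ} (ha : ∀ i, ContDiff ℝ ∞ (a i)) (β : Fin d → ℕ) :
    ContDiff ℝ ∞ (tensorDeriv a β) :=
  contDiff_tensor fun i => contDiff_iteratedDeriv (ha i) (β i)

/-- On a line in direction j only the j-th factor varies, so the partial derivative is a
one-dimensional derivative. -/
lemma fderiv_tensorDeriv {a : Fin d → ℝ → ℂ} (ha : ∀ i, ContDiff ℝ ∞ (a i)) (β : Fin d → ℕ)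
    (j : Fin d) (x : Fin d → ℝ) :
    fderiv ℝ (tensorDeriv a β) x (Pi.single j 1) = tensorDeriv a (β + Pi.single j 1) x := by
  have hdiff : DifferentiableAt ℝ (tensorDeriv a β) x :=
    (contDiff_tensorDeriv ha β).differentiable (by simp) x
  rw [← hdiff.lineDeriv_eq_fderiv, lineDeriv]
  have h1 : (fun t : ℝ => tensorDeriv a β (x + t • Pi.single j 1)) = fun t : ℝ =>
      iteratedDeriv (β j) (a j) (x j + t) *
        ∏ i ∈ Finset.univ.erase j, iteratedDeriv (β i) (a i) (x i) := by
    funext t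
    rw [← tensor_update_point (fun i => iteratedDeriv (β i) (a i)) j (x j + t) x, update_add_eq,
      tensorDeriv, ← Pi.single_smul, smul_eq_mul, mul_one]
  have h2 : tensorDeriv a (β + Pi.single j 1) x = iteratedDeriv (β j + 1) (a j) (x j) *
      ∏ i ∈ Finset.univ.erase j, iteratedDeriv (β i) (a i) (x i) := by
    rw [tensorDeriv, tensor, ← Finset.mul_prod_erase _ _ (Finset.mem_univ j)]
    congr 1
    · simp
    · refine Finset.prod_congr rfl fun i hi => ?_
      simp [Finset.ne_of_mem_erase hi]
  have h3 : HasDerivAt (fun t : ℝ => iteratedDeriv (β j) (a j) (x j + t))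
      (iteratedDeriv (β j + 1) (a j) (x j)) 0 := by
    have := ((contDiff_iteratedDeriv (ha j) (β j)).differentiable (by simp) (x j + 0)).hasDerivAt
    rw [add_zero, ← iteratedDeriv_succ] at this
    have h := HasDerivAt.comp_const_add (x j) (0 : ℝ) (by rwa [add_zero])
    exact h
  rw [h1, h2]
  exact (h3.mul_const _).deriv

lemma integrable_test_smul {K : Set (Fin d → ℝ)} (hK : IsCompact K) {φ : (Fin d → ℝ) → ℝ}
    (hφ : IsTestOn K φ) {u : (Fin d → ℝ) → ℂ} (hu : Continuous u) :
    Integrable (fun x => φ x • u x) volume :=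
  (hφ.contDiff.continuous.smul hu).integrable_of_hasCompactSupport
    ((hφ.hasCompactSupport hK).smul_right)

lemma integral_partialDeriv_smul {K : Set (Fin d → ℝ)} (hK : IsCompact K)
    {a : Fin d → ℝ → ℂ} (ha : ∀ i, ContDiff ℝ ∞ (a i)) (β : Fin d → ℕ)
    {φ : (Fin d → ℝ) → ℝ} (hφ : IsTestOn K φ) (j : Fin d) :
    ∫ x, partialDeriv j φ x • tensorDeriv a β x =
      -∫ x, φ x • tensorDeriv a (β + Pi.single j 1) x := by
  have hc := fun γ => (contDiff_tensorDeriv ha γ).continuous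
  have := integral_smul_fderiv_eq_neg_fderiv_smul_of_integrable (μ := volume) (f := φ)
    (g := tensorDeriv a β) (v := Pi.single j 1)
    (integrable_test_smul hK (hφ.partialDeriv j) (hc β))
    (by simpa only [fderiv_tensorDeriv ha] using integrable_test_smul hK hφ (hc _))
    (integrable_test_smul hK hφ (hc β))
    (fun x _ => hφ.contDiff.differentiable (by simp) x)
    (fun x _ => (contDiff_tensorDeriv ha β).differentiable (by simp) x)
  simp only [fderiv_tensorDeriv ha] at this
  rw [this, neg_neg]
  rfl

lemma integral_partialDeriv_iterate_smul {K : Set (Fin d → ℝ)} (hK : IsCompact K)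
    {a : Fin d → ℝ → ℂ} (ha : ∀ i, ContDiff ℝ ∞ (a i)) (β : Fin d → ℕ)
    {φ : (Fin d → ℝ) → ℝ} (hφ : IsTestOn K φ) (j : Fin d) (k : ℕ) :
    ∫ x, (partialDeriv j)^[k] φ x • tensorDeriv a β x =
      (-1 : ℝ) ^ k • ∫ x, φ x • tensorDeriv a (β + Pi.single j k) x := by
  induction k generalizing β with
  | zero => simp
  | succ k ih =>
    rw [Function.iterate_succ_apply',
      integral_partialDeriv_smul hK ha β (hφ.partialDeriv_iterate j k), ih, add_assoc,
      ← Pi.single_add, add_comm 1 k, pow_succ, mul_neg_one, neg_smul]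

lemma integral_multiDeriv_smul {K : Set (Fin d → ℝ)} (hK : IsCompact K)
    {a : Fin d → ℝ → ℂ} (ha : ∀ i, ContDiff ℝ ∞ (a i))
    {φ : (Fin d → ℝ) → ℝ} (hφ : IsTestOn K φ) (α : Fin d → ℕ) :
    ∫ x, multiDeriv α φ x • tensor a x =
      (-1 : ℝ) ^ (∑ i, α i) • ∫ x, φ x • tensorDeriv a α x := by
  -- Derivatives are moved off φ one direction at a time and accumulate on the tensor product, so
  -- the order β already there must be arbitrary in the induction.
  have key : ∀ (L : List (Fin d)) (β : Fin d → ℕ),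
      ∫ x, L.foldr (fun i => (partialDeriv i)^[α i]) φ x • tensorDeriv a β x =
        (-1 : ℝ) ^ (L.map α).sum •
          ∫ x, φ x • tensorDeriv a (β + (L.map fun i => Pi.single i (α i)).sum) x := by
    intro L
    induction L with
    | nil => simp
    | cons j L ih =>
      intro β
      rw [List.foldr_cons, integral_partialDeriv_iterate_smul hK ha β (hφ.foldr α L), ih,
        List.map_cons, List.map_cons, List.sum_cons, List.sum_cons, pow_add, mul_smul, add_assoc]
  have := key (List.finRange d) 0
  rw [← Fin.sum_univ_def, ← Fin.sum_univ_def, Finset.univ_sum_single, zero_add] at this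
  rw [← this]
  simp [multiDeriv, coordComp, tensorDeriv]

lemma hasWeakDeriv_tensor {a : Fin d → ℝ → ℂ} (ha : ∀ i, ContDiff ℝ ∞ (a i)) (α : Fin d → ℕ) :
    HasWeakDeriv α (tensor a) (tensorDeriv a α) where
  locInt := (contDiff_tensor ha).continuous.locallyIntegrable
  locInt_deriv := (contDiff_tensorDeriv ha α).continuous.locallyIntegrable
  integral_eq _ hφ hc := integral_multiDeriv_smul hc ha ⟨hφ, subset_rfl⟩ α

end IntegrationByParts

/-! ### Upper and lower Sobolev bounds for plane waves -/

section SobolevBounds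

variable {d : ℕ}

lemma iteratedDeriv_eq_zero_outside {g : ℝ → ℂ} {R : ℝ} (hg : ∀ t, R < |t| → g t = 0) (k : ℕ)
    {t : ℝ} (ht : R < |t|) : iteratedDeriv k g t = 0 := by
  have h : g =ᶠ[nhds t] fun _ => 0 := by
    filter_upwards [(isOpen_lt continuous_const continuous_abs).mem_nhds ht] with u hu
    exact hg u hu
  rw [h.iteratedDeriv_eq k]
  simp

lemma memSobolevMix_cutWave {ψ : ℝ → ℂ} (hψ : ContDiff ℝ ∞ ψ) (hc : HasCompactSupport ψ)
    (m : ℕ) (p : ℝ≥0∞) (ν : Fin d → ℝ) : MemSobolevMix m p (cutWave ψ ν) := by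
  obtain ⟨R, hR, h₃⟩ := exists_zero_outside hc
  have hs := fun i => contDiff_modulate hψ (ν i)
  refine ⟨memLp_tensor (fun i => (hs i).continuous) (fun i => modulate_eq_zero h₃ (ν i)) p,
    fun α _ => ⟨_, hasWeakDeriv_tensor hs α, ?_⟩⟩
  exact memLp_tensor (fun i => (contDiff_iteratedDeriv (hs i) _).continuous)
    (fun i t ht => iteratedDeriv_eq_zero_outside (modulate_eq_zero h₃ (ν i)) _ ht) p

lemma memSobolevMixCube_wave (m : ℕ) (p : ℝ≥0∞) (ν : Fin d → ℝ) :
    MemSobolevMixCube m p (wave ν) := by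
  obtain ⟨ψ, hψ, hc, h1⟩ := exists_cutoff
  exact ⟨_, memSobolevMix_cutWave hψ hc m p ν, cutWave_ae_eq_wave h1 ν⟩

lemma exists_weakDerivNorm_cutWave_le {ψ : ℝ → ℂ} (hψ : ContDiff ℝ ∞ ψ)
    (hc : HasCompactSupport ψ) (p : ℝ≥0∞) (α : Fin d → ℕ) :
    ∃ D : ℝ≥0∞, D ≠ ⊤ ∧ ∀ ν : Fin d → ℝ,
      weakDerivNorm α p (cutWave ψ ν) ≤ D * ENNReal.ofReal (∏ i, (1 + |ν i|) ^ α i) := by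
  choose C hC h using fun i : Fin d => exists_norm_iteratedDeriv_modulate_le (α i) hψ hc
  obtain ⟨R, hR, h₃⟩ := exists_zero_outside hc
  refine ⟨volume (Set.Icc (fun _ : Fin d => -R) (fun _ => R)) ^ p.toReal⁻¹ *
    ENNReal.ofReal (∏ i, C i), ENNReal.mul_ne_top ?_ ENNReal.ofReal_ne_top, fun ν => ?_⟩
  · exact ENNReal.rpow_ne_top_of_nonneg (by positivity) isCompact_Icc.measure_lt_top.ne
  refine (iInf₂_le _ (hasWeakDeriv_tensor (fun i => contDiff_modulate hψ (ν i)) α)).trans ?_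
  refine (eLpNorm_tensor_le (R := R) (B := fun i => C i * (1 + |ν i|) ^ α i)
    (fun i t ht => iteratedDeriv_eq_zero_outside (modulate_eq_zero h₃ (ν i)) _ ht)
    (fun i t => h i (ν i) t) p).trans (le_of_eq ?_)
  rw [Finset.prod_mul_distrib, ENNReal.ofReal_mul (Finset.prod_nonneg fun i _ => hC i), mul_assoc]

lemma exists_sobolevMixCubeNorm_wave_le (d m : ℕ) (p : ℝ≥0∞) :
    ∃ D : ℝ≥0∞, D ≠ ⊤ ∧ ∀ ν : Fin d → ℝ,
      sobolevMixCubeNorm m p (wave ν) ≤ D * ENNReal.ofReal (∏ i, (1 + |ν i|) ^ m) := by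
  obtain ⟨ψ, hψ, hc, h1⟩ := exists_cutoff
  choose D hD h using fun α : Fin d → ℕ => exists_weakDerivNorm_cutWave_le hψ hc p α
  refine ⟨∑ α ∈ Fintype.piFinset (fun _ : Fin d => Finset.range (m + 1)), D α,
    ENNReal.sum_ne_top.2 fun α _ => hD α, fun ν => ?_⟩
  refine (iInf₂_le _ ⟨memSobolevMix_cutWave hψ hc m p ν, cutWave_ae_eq_wave h1 ν⟩).trans ?_
  rw [sobolevMixNorm, Finset.sum_mul]
  refine Finset.sum_le_sum fun α hα => (h α ν).trans ?_
  gcongr with i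
  · linarith [abs_nonneg (ν i)]
  · exact Nat.lt_succ_iff.1 (Finset.mem_range.1 (Fintype.mem_piFinset.1 hα i))

lemma iteratedDeriv_expLine (ν : ℝ) (k : ℕ) :
    iteratedDeriv k (fun t : ℝ => Complex.exp (ν * t * Complex.I)) =
      fun t : ℝ => (ν * Complex.I) ^ k * Complex.exp (ν * t * Complex.I) := by
  induction k with
  | zero => simp
  | succ k ih =>
    rw [iteratedDeriv_succ, ih]
    funext t
    have h1 : HasDerivAt (fun t : ℝ => (ν : ℂ) * t * Complex.I) (ν * Complex.I) t := by
      simpa using (((hasDerivAt_id t).ofReal_comp).const_mul (ν : ℂ)).mul_const Complex.I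
    rw [(h1.cexp.const_mul _).deriv]
    ring

lemma tensorDeriv_expLine (ν : Fin d → ℝ) (α : Fin d → ℕ) (x : Fin d → ℝ) :
    tensorDeriv (fun i t => Complex.exp (ν i * t * Complex.I)) α x =
      (∏ i, (ν i * Complex.I) ^ α i) * wave ν x := by
  simp only [tensorDeriv, wave, tensor, iteratedDeriv_expLine, Finset.prod_mul_distrib]

/-- All derivatives of φ live in the cube, where G is the wave. Hence v and the classical derivative
of the wave, which is the wave times ∏ (iν_i)^(α_i), have the same integral against φ. -/
lemma norm_integral_test_smul_wave_le {α : Fin d → ℕ} {ν : Fin d → ℝ}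
    {G v : (Fin d → ℝ) → ℂ} (hG : G =ᵐ[volume.restrict (cube d)] wave ν)
    (hv : HasWeakDeriv α G v) {φ : (Fin d → ℝ) → ℝ} (hφ : IsTestOn (cube d) φ)
    (hφ1 : ∀ x, |φ x| ≤ 1) :
    (∏ i, |ν i| ^ α i) * ‖∫ x, φ x • wave ν x‖ ≤ ∫ x in cube d, ‖v x‖ := by
  have hK : IsCompact (cube d) := isCompact_Icc
  have h1 : ∫ x, multiDeriv α φ x • G x = ∫ x, multiDeriv α φ x • wave ν x := by
    refine integral_congr_ae ?_
    filter_upwards [(ae_restrict_iff' measurableSet_Icc).1 hG] with x hx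
    by_cases hxc : x ∈ cube d
    · rw [hx hxc]
    · rw [(hφ.multiDeriv α).eq_zero hxc, zero_smul, zero_smul]
  rw [hv.integral_eq φ hφ.contDiff (hφ.hasCompactSupport hK), wave,
    integral_multiDeriv_smul hK (fun i => contDiff_expLine (ν i)) hφ α] at h1
  -- Both sides of `h1` now carry the same nonzero sign, which is cancelled.
  have h2 : ∫ x, φ x • v x =
      ∫ x, φ x • tensorDeriv (fun i t => Complex.exp (ν i * t * Complex.I)) α x :=
    smul_right_injective _ (pow_ne_zero _ (by norm_num)) h1
  simp only [tensorDeriv_expLine, ← mul_smul_comm, integral_const_mul] at h2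
  calc (∏ i, |ν i| ^ α i) * ‖∫ x, φ x • wave ν x‖ = ‖∫ x, φ x • v x‖ := by
        rw [h2, norm_mul, norm_prod]
        simp
    _ = ‖∫ x in cube d, φ x • v x‖ := by
        rw [setIntegral_eq_integral_of_forall_compl_eq_zero]
        intro x hx
        rw [hφ.eq_zero hx, zero_smul]
    _ ≤ _ := by
        refine norm_integral_le_of_norm_le (hv.locInt_deriv.integrableOn_isCompact hK).norm
          (ae_of_all _ fun x => ?_)
        rw [norm_smul, Real.norm_eq_abs]
        exact mul_le_of_le_one_left (norm_nonneg _) (hφ1 x)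

/-- The natural test function is b times the conjugate wave w, whose pairing with w is ∫ b. Test
functions being real, it is split into b·Re w and b·Im w; the two pairings have moduli adding up to
at least ∫ b, whence the constant (∫ b)/2. Finally, the L_1 norm is at most the L_p norm on the
cube, which has measure one. -/
lemma exists_le_weakDerivNorm (d : ℕ) : ∃ c : ℝ, 0 < c ∧ ∀ (p : ℝ≥0∞) (α : Fin d → ℕ)
    (ν : Fin d → ℝ) (G : (Fin d → ℝ) → ℂ), 1 ≤ p → G =ᵐ[volume.restrict (cube d)] wave ν →
    ENNReal.ofReal (c * ∏ i, |ν i| ^ α i) ≤ weakDerivNorm α p G := by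
  -- In the sup metric the closed ball of radius 1/2 about the centre is the cube itself.
  let b : ContDiffBump (fun _ : Fin d => (1 / 2 : ℝ)) :=
    ⟨1 / 4, 1 / 2, by norm_num, by norm_num⟩
  have hb : IsTestOn (cube d) b := by
    refine ⟨b.contDiff, ?_⟩
    rw [b.tsupport_eq]
    intro x hx
    have h := (dist_pi_le_iff (by norm_num)).1 (Metric.mem_closedBall.1 hx)
    constructor <;> intro i <;> have := abs_le.1 ((Real.dist_eq _ _).symm.trans_le (h i)) <;>
      simp only [b, Pi.zero_apply, Pi.one_apply] at * <;> linarith [this.1, this.2]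
  have hI : 0 < ∫ x, b x := b.integral_pos
  refine ⟨(∫ x, b x) / 2, by positivity, fun p α ν G hp hG => le_iInf₂ fun v hv => ?_⟩
  have hK : IsCompact (cube d) := isCompact_Icc
  have htest : ∀ w : (Fin d → ℝ) → ℝ, ContDiff ℝ ∞ w →
      IsTestOn (cube d) fun x => b x * w x := fun w hw =>
    ⟨hb.contDiff.mul hw, (tsupport_mul_subset_left).trans hb.tsupport_subset⟩
  have hw := contDiff_wave ν
  have hre := htest (fun x => (wave ν x).re) (Complex.reCLM.contDiff.comp hw)
  have him := htest (fun x => (wave ν x).im) (Complex.imCLM.contDiff.comp hw)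
  have hle : ∀ y : ℝ, ∀ x, |y| ≤ ‖wave ν x‖ → |b x * y| ≤ 1 := by
    intro y x hy
    rw [abs_mul, abs_of_nonneg b.nonneg]
    rw [norm_wave] at hy
    exact mul_le_one₀ b.le_one (abs_nonneg _) hy
  have h1 := norm_integral_test_smul_wave_le hG hv hre
    fun x => hle _ x (Complex.abs_re_le_norm _)
  have h2 := norm_integral_test_smul_wave_le hG hv him
    fun x => hle _ x (Complex.abs_im_le_norm _)
  have hsplit : ((∫ x, b x : ℝ) : ℂ) = (∫ x, (b x * (wave ν x).re) • wave ν x) -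
      Complex.I * ∫ x, (b x * (wave ν x).im) • wave ν x := by
    rw [← integral_const_mul, ← integral_sub (integrable_test_smul hK hre hw.continuous)
      ((integrable_test_smul hK him hw.continuous).const_mul _), ← integral_complex_ofReal]
    refine integral_congr_ae (ae_of_all _ fun x => ?_)
    have hsq : (wave ν x).re * (wave ν x).re + (wave ν x).im * (wave ν x).im = 1 := by
      rw [← Complex.normSq_apply, Complex.normSq_eq_norm_sq, norm_wave, one_pow]
    apply Complex.ext
    · simp
      linear_combination (-b x) * hsq
    · simp
      ring
  have h3 : ∫ x, b x ≤ ‖∫ x, (b x * (wave ν x).re) • wave ν x‖ +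
      ‖∫ x, (b x * (wave ν x).im) • wave ν x‖ := by
    have := congrArg norm hsplit
    rw [Complex.norm_real, Real.norm_of_nonneg hI.le] at this
    rw [this]
    refine (norm_sub_le _ _).trans (le_of_eq ?_)
    rw [norm_mul, Complex.norm_I, one_mul]
  have hN : 0 ≤ ∏ i, |ν i| ^ α i := Finset.prod_nonneg fun i _ => by positivity
  have hfin : (∫ x, b x) / 2 * ∏ i, |ν i| ^ α i ≤ ∫ x in cube d, ‖v x‖ := by
    nlinarith [mul_le_mul_of_nonneg_left h3 hN]
  have hint : IntegrableOn v (cube d) := hv.locInt_deriv.integrableOn_isCompact hK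
  have : IsProbabilityMeasure (volume.restrict (cube d)) :=
    ⟨by rw [Measure.restrict_apply_univ, volume_cube]⟩
  calc ENNReal.ofReal ((∫ x, b x) / 2 * ∏ i, |ν i| ^ α i)
      ≤ ENNReal.ofReal (∫ x in cube d, ‖v x‖) := ENNReal.ofReal_le_ofReal hfin
    _ = eLpNorm v 1 (volume.restrict (cube d)) := by
        rw [ofReal_integral_norm_eq_lintegral_enorm hint, eLpNorm_one_eq_lintegral_enorm]
    _ ≤ eLpNorm v p (volume.restrict (cube d)) :=
        eLpNorm_le_eLpNorm_of_exponent_le hp hint.aestronglyMeasurable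
    _ ≤ _ := eLpNorm_restrict_le _ _ _ _

lemma exists_le_sobolevMixCubeNorm_wave (d : ℕ) : ∃ c : ℝ, 0 < c ∧ ∀ (m : ℕ) (p : ℝ≥0∞)
    (e : Finset (Fin d)) (n : ℝ), 1 ≤ p → 0 ≤ n →
    ENNReal.ofReal (c * n ^ (m * e.card)) ≤
      sobolevMixCubeNorm m p (wave fun i => if i ∈ e then n else 0) := by
  obtain ⟨c, hc, h⟩ := exists_le_weakDerivNorm d
  refine ⟨c, hc, fun m p e n hp hn => le_iInf₂ fun G hG => ?_⟩
  -- The top mixed derivative, of order m in each direction of e, alone gives the growth n^(m·#e).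
  set α : Fin d → ℕ := fun i => if i ∈ e then m else 0 with hα
  have hmem : α ∈ Fintype.piFinset (fun _ : Fin d => Finset.range (m + 1)) := by
    refine Fintype.mem_piFinset.2 fun i => Finset.mem_range.2 ?_
    simp only [hα]
    split_ifs <;> omega
  refine le_trans ?_ (Finset.single_le_sum (fun _ _ => zero_le) hmem)
  refine le_trans (le_of_eq ?_) (h p α _ G hp hG.2)
  have hprod : ∀ i, |if i ∈ e then n else 0| ^ α i = if i ∈ e then n ^ m else 1 := by
    intro i
    simp only [hα]
    split_ifs
    · rw [abs_of_nonneg hn]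
    · simp
  rw [Finset.prod_congr rfl fun i _ => hprod i, Fintype.prod_ite_mem, Finset.prod_const, pow_mul]

end SobolevBounds

end DominatingMixed

namespace DominatingMixed

/-! ### Contradiction by comparing growth rates -/

section Growth

variable {d : ℕ}

/-- The frequency vector that equals `n` in the directions of `e` and vanishes elsewhere. -/
def freq (e : Finset (Fin d)) (n : ℝ) : Fin d → ℝ := fun i => if i ∈ e then n else 0

lemma freq_add_freq {i j : Fin d} (hij : i ≠ j) (n : ℝ) :
    freq {i} n + freq {j} n = freq {i, j} n := by
  funext k
  simp only [freq, Pi.add_apply, Finset.mem_insert, Finset.mem_singleton]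
  rcases eq_or_ne k i with rfl | hk
  · simp [hij]
  · simp [hk]

lemma prod_freq_singleton (w : ℝ → ℝ) (hw : w 0 = 1) (i : Fin d) {n : ℝ} (hn : 0 ≤ n) :
    ∏ k, w |freq {i} n k| = w n := by
  rw [Finset.prod_eq_single_of_mem i (Finset.mem_univ i)]
  · simp [freq, abs_of_nonneg hn]
  · intro k _ hk
    simp [freq, hk, hw]

/-- Shared by both scales of spaces: since waves have sup norm at most 1, the product estimate turns
bounds for the norms into a real inequality between growth rates. -/
lemma le_of_product_estimate {N : ((Fin d → ℝ) → ℂ) → ℝ≥0∞} {C : ℝ≥0} {D : ℝ≥0∞} (hD : D ≠ ⊤)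
    {ν μ : Fin d → ℝ} {X Y : ℝ} (hY : 0 ≤ Y) (hX : ENNReal.ofReal X ≤ N (wave (ν + μ)))
    (hν : N (wave ν) ≤ D * ENNReal.ofReal Y) (hμ : N (wave μ) ≤ D * ENNReal.ofReal Y)
    (h : N (fun x => wave ν x * wave μ x) ≤
      C * (N (wave ν) * supCubeNorm (wave μ) + supCubeNorm (wave ν) * N (wave μ))) :
    X ≤ 2 * C * D.toReal * Y := by
  rw [wave_mul_wave] at h
  have h1 : ENNReal.ofReal X ≤ ENNReal.ofReal (2 * C * D.toReal * Y) := by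
    calc ENNReal.ofReal X
        ≤ C * (N (wave ν) * supCubeNorm (wave μ) + supCubeNorm (wave ν) * N (wave μ)) :=
          hX.trans h
      _ ≤ C * (D * ENNReal.ofReal Y * 1 + 1 * (D * ENNReal.ofReal Y)) := by
          gcongr
          exacts [supCubeNorm_wave_le μ, supCubeNorm_wave_le ν]
      _ = _ := by
          rw [ENNReal.ofReal_mul (by positivity), ENNReal.ofReal_mul (by positivity),
            ENNReal.ofReal_mul (by positivity), ENNReal.ofReal_toReal hD, ENNReal.ofReal_coe_nnreal]
          simp
          ring
  exact (ENNReal.ofReal_le_ofReal_iff (by positivity)).1 h1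

lemma not_eventually_le_of_lt {c K u v : ℝ} (hc : 0 < c) (hv : 0 < v) (huv : v < u) (j₀ : ℕ) :
    ¬ ∀ j : ℕ, j₀ ≤ j → c * u ^ j ≤ K * v ^ j := by
  intro h
  obtain ⟨j, hj⟩ := pow_unbounded_of_one_lt (K / c) ((one_lt_div hv).2 huv)
  have h1 := h (max j j₀) (le_max_right _ _)
  have h2 : (u / v) ^ j ≤ (u / v) ^ max j j₀ :=
    pow_le_pow_right₀ ((one_lt_div hv).2 huv).le (le_max_left _ _)
  rw [← div_le_iff₀ (by positivity), mul_div_assoc, ← div_pow, ← le_div_iff₀' hc] at h1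
  linarith

lemma not_sobolev_product_estimate {i j : Fin d} (hij : i ≠ j) {m : ℕ} {p : ℝ≥0∞} (hm : 1 ≤ m)
    (hp : 1 < p) :
    ¬ ∃ C : ℝ≥0, 0 < C ∧ ∀ f g : (Fin d → ℝ) → ℂ,
      MemSobolevMixCube m p f → MemSobolevMixCube m p g →
      sobolevMixCubeNorm m p (fun x => f x * g x) ≤
        C * (sobolevMixCubeNorm m p f * supCubeNorm g +
          supCubeNorm f * sobolevMixCubeNorm m p g) := by
  rintro ⟨C, -, hC⟩
  obtain ⟨D, hD, hup⟩ := exists_sobolevMixCubeNorm_wave_le d m p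
  obtain ⟨c, hc, hlow⟩ := exists_le_sobolevMixCubeNorm_wave d
  -- With n = 2^k the product grows like (2^(2m))^k and the factors like (2^m)^k; the 2^m in K comes
  -- from 1 + 2^k ≤ 2·2^k.
  refine not_eventually_le_of_lt (c := c) (K := 2 * C * D.toReal * 2 ^ m) (u := 2 ^ (m * 2))
    (v := 2 ^ m) hc (by positivity) (pow_lt_pow_right₀ one_lt_two (by omega)) 0 fun k _ => ?_
  have hn : (1 : ℝ) ≤ 2 ^ k := one_le_pow₀ one_le_two
  have hupi : ∀ l : Fin d, sobolevMixCubeNorm m p (wave (freq {l} (2 ^ k))) ≤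
      D * ENNReal.ofReal ((1 + 2 ^ k) ^ m) := fun l => by
    have h := hup (freq {l} (2 ^ k))
    rwa [prod_freq_singleton (fun t => (1 + t) ^ m) (by simp) l (by positivity)] at h
  have hX := hlow m p {i, j} (2 ^ k) hp.le (by positivity)
  rw [Finset.card_pair hij] at hX
  have h1 := le_of_product_estimate hD (by positivity) (by rw [freq_add_freq hij]; exact hX)
    (hupi i) (hupi j) (hC _ _ (memSobolevMixCube_wave m p _) (memSobolevMixCube_wave m p _))
  rw [← pow_mul, mul_comm _ k, pow_mul]
  refine h1.trans ?_
  rw [mul_assoc _ ((2 : ℝ) ^ m), ← pow_mul, mul_comm m k, pow_mul, ← mul_pow]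
  gcongr
  linarith

lemma not_besov_product_estimate {i j : Fin d} (hij : i ≠ j) {r : ℝ} {p : ℝ≥0∞} (hr : 0 < r)
    (hp : 1 ≤ p) :
    ¬ ∃ C : ℝ≥0, 0 < C ∧ ∀ f g : (Fin d → ℝ) → ℂ,
      MemBesovMixCube r p f → MemBesovMixCube r p g →
      MemLp f ⊤ (volume.restrict (cube d)) → MemLp g ⊤ (volume.restrict (cube d)) →
      MemBesovMixCube r p (fun x => f x * g x) →
      besovMixCubeNorm r p (fun x => f x * g x) ≤
        C * (besovMixCubeNorm r p f * supCubeNorm g +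
          supCubeNorm f * besovMixCubeNorm r p g) := by
  rintro ⟨C, -, hC⟩
  have hp0 : p ≠ 0 := (one_pos.trans_le hp).ne'
  -- The exponent must exceed r for the upper bound, not exceed the order of the differences, and
  -- stay below 2r for the contradiction.
  set s := min (⌊r⌋₊ + 1 : ℝ) (3 / 2 * r) with hs
  have hrs : r < s := lt_min (Nat.lt_floor_add_one r) (by linarith)
  have hs2 : s < r * 2 := (min_le_right _ _).trans_lt (by linarith)
  have hs0 : 0 < s := hr.trans hrs
  obtain ⟨D, hD, hup⟩ := exists_besovMixCubeNorm_wave_le d hr hrs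
    (by push_cast; exact min_le_left _ _) hp0
  obtain ⟨c, hc, j₀, hlow⟩ := exists_le_besovMixCubeNorm_wave (r := r) hp0 ({i, j} : Finset (Fin d))
  -- The constant c is only known to be nonzero in [0, ∞]; truncating it at 1 makes it a positive
  -- real.
  have hc1 : min c 1 ≠ ⊤ := ((min_le_right _ _).trans_lt ENNReal.one_lt_top).ne
  have hc0 : 0 < (min c 1).toReal :=
    ENNReal.toReal_pos (lt_min (pos_iff_ne_zero.2 hc) one_pos).ne' hc1
  -- The factor 8^s in K comes from 1 + 4·2^k ≤ 8·2^k.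
  refine not_eventually_le_of_lt (c := (min c 1).toReal) (K := 2 * C * D.toReal * 8 ^ s)
    (u := 2 ^ (r * 2)) (v := 2 ^ s) hc0 (by positivity)
    (Real.rpow_lt_rpow_of_exponent_lt one_lt_two hs2) j₀ fun k hk => ?_
  set n : ℝ := 4 * 2 ^ k with hn
  have hk1 : (1 : ℝ) ≤ 2 ^ k := one_le_pow₀ one_le_two
  have hupi : ∀ l : Fin d, besovMixCubeNorm r p (wave (freq {l} n)) ≤
      D * ENNReal.ofReal ((1 + n) ^ s) := fun l => by
    have h := hup (freq {l} n)
    rwa [prod_freq_singleton (fun t => (1 + t) ^ s) (by simp) l (by positivity)] at h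
  have hX : ENNReal.ofReal ((min c 1).toReal * ((2 : ℝ) ^ (r * 2)) ^ k) ≤
      besovMixCubeNorm r p (wave (freq {i, j} n)) := by
    refine le_trans ?_ (hlow k hk)
    rw [Finset.card_pair hij, ENNReal.ofReal_mul hc0.le, ENNReal.ofReal_toReal hc1,
      ← Real.rpow_mul_natCast zero_le_two, ← ENNReal.ofReal_rpow_of_pos zero_lt_two, mul_assoc]
    simp only [ENNReal.ofReal_ofNat, Nat.cast_ofNat]
    gcongr
    exact min_le_left _ _
  have hprod := memBesovMixCube_wave hr hp0 (freq {i} n + freq {j} n)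
  rw [← wave_mul_wave] at hprod
  have h1 := le_of_product_estimate hD (by positivity) (by rw [freq_add_freq hij]; exact hX)
    (hupi i) (hupi j) (hC _ _ (memBesovMixCube_wave hr hp0 _) (memBesovMixCube_wave hr hp0 _)
      (memLp_top_wave _) (memLp_top_wave _) hprod)
  refine h1.trans ?_
  rw [mul_assoc _ ((8 : ℝ) ^ s), ← Real.rpow_mul_natCast zero_le_two, mul_comm s,
    Real.rpow_natCast_mul zero_le_two, ← Real.mul_rpow (by norm_num) (by positivity)]
  gcongr
  linarith

end Growth

end DominatingMixed
theorem theorem3p13 (d : ℕ) (hd : 1 < d) :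
    (∀ (m : ℕ) (p : ℝ≥0∞), 1 ≤ m → 1 < p → p < ⊤ →
      ¬ ∃ C : ℝ≥0, 0 < C ∧ ∀ f g : (Fin d → ℝ) → ℂ,
        DominatingMixed.MemSobolevMixCube m p f → DominatingMixed.MemSobolevMixCube m p g →
        DominatingMixed.sobolevMixCubeNorm m p (fun x => f x * g x) ≤
          C * (DominatingMixed.sobolevMixCubeNorm m p f * DominatingMixed.supCubeNorm g +
            DominatingMixed.supCubeNorm f * DominatingMixed.sobolevMixCubeNorm m p g)) ∧
    (∀ (r : ℝ) (p : ℝ≥0∞), 0 < r → 1 ≤ p →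
      ¬ ∃ C : ℝ≥0, 0 < C ∧ ∀ f g : (Fin d → ℝ) → ℂ,
        DominatingMixed.MemBesovMixCube r p f → DominatingMixed.MemBesovMixCube r p g →
        MemLp f ⊤ (volume.restrict (DominatingMixed.cube d)) →
        MemLp g ⊤ (volume.restrict (DominatingMixed.cube d)) →
        DominatingMixed.MemBesovMixCube r p (fun x => f x * g x) →
        DominatingMixed.besovMixCubeNorm r p (fun x => f x * g x) ≤
          C * (DominatingMixed.besovMixCubeNorm r p f * DominatingMixed.supCubeNorm g +
            DominatingMixed.supCubeNorm f * DominatingMixed.besovMixCubeNorm r p g)) := by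
  have hij : (⟨0, by omega⟩ : Fin d) ≠ ⟨1, hd⟩ := by simp
  exact ⟨fun m p hm hp _ => DominatingMixed.not_sobolev_product_estimate hij hm hp,
    fun r p hr hp => DominatingMixed.not_besov_product_estimate hij hr hp⟩
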